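/- Let $\Sigma$ be an alphabet (a set, possibly infinite). A factorization $T=f_1\cdots f_z$ of a string $T\in\Sigma^*$ into non-empty phrases is LZ-style if each $f_k$ is either a fresh character (a single character not occurring in $f_1\cdots f_{k-1}$) or a copy of a substring of $T$ that has an occurrence starting to the left of $f_k$. It is an LZ-End factorization if moreover each phrase $f_k$ that is not a fresh character is a suffix of $f_1\cdots f_h$ for some $1\le h<k$. Let $z_{\mathrm{End}}^{\mathrm{opt}}(T)$ be the least number $z$ of phrases of an LZ-End factorization of $T$. For an edit type $\mathrm{edit}\in\{\mathrm{sub},\mathrm{ins},\mathrm{del}\}$ and $n\ge 1$ let $$\mathrm{AS}_{\mathrm{edit}}^{\Sigma}(n)=\max\{z_{\mathrm{End}}^{\mathrm{opt}}(T')-z_{\mathrm{End}}^{\mathrm{opt}}(T)\;:\;T\in\Sigma^n,\ T'\in\Sigma^m,\ \mathrm{ed}(T,T')=1\},$$ where $\mathrm{ed}$ is the edit distance (least number of single-character substitutions, insertions and deletions turning one string into the other), and $m=n$ for $\mathrm{sub}$, $m=n+1$ for $\mathrm{ins}$, $m=n-1$ for $\mathrm{del}$; the maximum over the empty set is taken to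 be $0$. Theorem. (a) There is an absolute constant $C$ such that $\mathrm{AS}_{\mathrm{edit}}^{\Sigma}(n)\le C\,n^{2/3}$ for every alphabet $\Sigma$, every $\mathrm{edit}\in\{\mathrm{sub},\mathrm{ins},\mathrm{del}\}$ and every $n\ge 1$. (b) There are absolute constants $c>0$ and $N$ such that $\mathrm{AS}_{\mathrm{edit}}^{\Sigma}(n)\ge c\,n^{2/3}$ for every infinite alphabet $\Sigma$, every $\mathrm{edit}\in\{\mathrm{sub},\mathrm{ins},\mathrm{del}\}$ and every $n\ge N$. Hence, over an unbounded alphabet, the worst-case additive sensitivity of the optimal LZ-End factorization size is $\Theta(n^{2/3})$ for substitutions, insertions and deletions. -/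

import Mathlib

universe u

/-- The phrase number `k` (counted from `0`) of the sequence of phrases `fs` is a fresh character:
a single character that does not occur to its left. -/
def IsFreshPhrase {α : Type*} (fs : List (List α)) (k : ℕ) : Prop :=
  ∃ a : α, fs[k]? = some [a] ∧ a ∉ (fs.take k).flatten

/-- The phrase number `k` (counted from `0`) of `fs` is a copy of a substring occurring to its
left: it also occurs in `f_0 ⋯ f_k` at a position `i` (counted from `0`) smaller than its own
starting position `|f_0 ⋯ f_{k-1}|`. The two occurrences may overlap. -/
def IsCopiedPhrase {α : Type*} (fs : List (List α)) (k : ℕ) : Prop :=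
  ∃ f : List α, fs[k]? = some f ∧
    ∃ i : ℕ, i < (fs.take k).flatten.length ∧ f <+: (fs.take (k + 1)).flatten.drop i

/-- `fs` is an LZ-style factorization of the string `T`. -/
structure IsLZStyleFactorization {α : Type*} (T : List α) (fs : List (List α)) : Prop where
  flatten_eq : fs.flatten = T
  ne_nil : ∀ f ∈ fs, f ≠ []
  fresh_or_copied : ∀ k < fs.length, IsFreshPhrase fs k ∨ IsCopiedPhrase fs k

/-- `fs` is an LZ-End factorization of `T`: an LZ-style factorization in which each copied phrase
has an occurrence that ends where some previous phrase ends, that is, it is a suffix of the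
concatenation of the first `h` phrases, where `h ≥ 1` and these phrases all precede it. -/
structure IsLZEndFactorization {α : Type*} (T : List α) (fs : List (List α)) : Prop
    extends IsLZStyleFactorization T fs where
  source_ends : ∀ k f, fs[k]? = some f → ¬ IsFreshPhrase fs k →
    ∃ h : ℕ, 1 ≤ h ∧ h ≤ k ∧ f <:+ (fs.take h).flatten

/-- The size (number of phrases) of the optimal, i.e. smallest, LZ-End factorization of `T`. -/
noncomputable def lzEndOpt {α : Type*} (T : List α) : ℕ :=
  sInf {z : ℕ | ∃ fs : List (List α), IsLZEndFactorization T fs ∧ fs.length = z}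

/-- The three types of single-character edit operations. -/
inductive EditType where
  | sub
  | ins
  | del

/-- `m` is the length of a string obtained from a string of length `n` by an edit of the
given type. -/
def EditType.LengthRel : EditType → ℕ → ℕ → Prop
  | .sub, n, m => m = n
  | .ins, n, m => m = n + 1
  | .del, n, m => m + 1 = n

/-- `SingleEdit e S T`: the string `T` is obtained from `S` by one single-character edit operation
of type `e`. A substitution replaces a character by a different one. -/
inductive SingleEdit {α : Type*} : EditType → List α → List α → Prop where
  | sub (u v : List α) (a b : α) (hab : a ≠ b) : SingleEdit .sub (u ++ a :: v) (u ++ b :: v)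
  | ins (u v : List α) (b : α) : SingleEdit .ins (u ++ v) (u ++ b :: v)
  | del (u v : List α) (a : α) : SingleEdit .del (u ++ a :: v) (u ++ v)

/-- `EditPath k S T`: the string `S` can be turned into `T` by `k` single-character edits. -/
def EditPath {α : Type*} : ℕ → List α → List α → Prop
  | 0, S, T => S = T
  | k + 1, S, T => ∃ (e : EditType) (U : List α), SingleEdit e S U ∧ EditPath k U T

/-- The edit distance between two strings: the least number of single-character substitutions,
insertions and deletions that turn one into the other. -/
noncomputable def editDist {α : Type*} (S T : List α) : ℕ :=
  sInf {k : ℕ | EditPath k S T}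

/-- Strings at edit distance `1` whose lengths are related as prescribed by the type of the edit
are exactly those that arise by one edit of this type. -/
theorem editDist_eq_one_iff {α : Type*} (e : EditType) (S T : List α) :
    e.LengthRel S.length T.length ∧ editDist S T = 1 ↔ SingleEdit e S T := by
  constructor
  · rintro ⟨hl, h1⟩
    have hne : {k : ℕ | EditPath k S T}.Nonempty := Nat.nonempty_of_sInf_eq_succ h1
    have hm := Nat.sInf_mem hne
    have h1' : sInf {k : ℕ | EditPath k S T} = 1 := h1
    rw [h1'] at hm
    obtain ⟨e', U, hU, rfl⟩ := hm
    cases hU <;> cases e <;> simp [EditType.LengthRel] at hl <;>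
      first
        | (constructor; assumption)
        | constructor
        | omega
  · intro h
    have hl : e.LengthRel S.length T.length := by
      cases h <;> simp [EditType.LengthRel] <;> omega
    have hST : S ≠ T := by
      rintro rfl
      cases e with
      | sub =>
        generalize hT : S = T at h
        have hT' : SingleEdit .sub S T := by rw [← hT] at h ⊢; simpa using h
        clear h
        cases hT' with
        | sub u v a b hab => simp_all
      | ins => simp [EditType.LengthRel] at hl
      | del => simp [EditType.LengthRel] at hl
    refine ⟨hl, le_antisymm (Nat.sInf_le ⟨e, T, h, rfl⟩) ?_⟩
    rw [Nat.one_le_iff_ne_zero]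
    intro h0
    have hm := Nat.sInf_mem (s := {k : ℕ | EditPath k S T}) ⟨1, e, T, h, rfl⟩
    have h0' : sInf {k : ℕ | EditPath k S T} = 0 := h0
    rw [h0'] at hm
    exact hST hm

/-- The set of all differences `c(T') - c(T)`, where `T` has length `n`, `T'` is at edit distance
`1` from `T`, and the length of `T'` is the one prescribed by the type of the edit. -/
def sensitivitySet {α : Type*} (e : EditType) (c : List α → ℕ) (n : ℕ) : Set ℤ :=
  {d : ℤ | ∃ T T' : List α, T.length = n ∧ e.LengthRel n T'.length ∧ editDist T T' = 1 ∧
    d = (c T' : ℤ) - (c T : ℤ)}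

/-- The worst-case additive sensitivity of the measure `c` on strings of length `n` over `α`. -/
noncomputable def additiveSensitivity {α : Type*} (e : EditType) (c : List α → ℕ) (n : ℕ) : ℤ :=
  sSup (sensitivitySet e c n)

/-- The factorization into single characters is an LZ-End factorization, so that the infimum in
the definition of `lzEndOpt` is over a nonempty set. -/
theorem isLZEndFactorization_singletons {α : Type*} (T : List α) :
    IsLZEndFactorization T (T.map fun a => [a]) := by
  have hfl : ∀ l : List α, (l.map fun a => [a]).flatten = l := by
    intro l; induction l with
    | nil => rfl
    | cons a l ih => simp [ih]
  have key : ∀ k a, T[k]? = some a → a ∈ T.take k →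
      ∃ j < k, [a] <:+ T.take (j + 1) := by
    intro k a _ ha
    obtain ⟨j, hj, hja⟩ := List.getElem_of_mem ha
    have hj' : j < k ∧ j < T.length := by simpa using hj
    refine ⟨j, hj'.1, T.take j, ?_⟩
    rw [List.take_add_one, List.getElem?_eq_getElem hj'.2]
    simp at hja
    simp [hja]
  refine ⟨⟨hfl T, by simp, ?_⟩, ?_⟩
  · intro k hk
    have hk' : k < T.length := by simpa using hk
    by_cases ha : T[k] ∈ T.take k
    · right
      obtain ⟨j, hj, t, ht⟩ := key k T[k] (List.getElem?_eq_getElem hk') ha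
      have hjl : j + 1 ≤ T.length := by omega
      have htl : t.length = j := by
        have := congrArg List.length ht
        simp at this; omega
      refine ⟨[T[k]], by simp [List.getElem?_eq_getElem hk'], j, ?_, ?_⟩
      · rw [← List.map_take, hfl, List.length_take]; omega
      · rw [← List.map_take, hfl]
        have h1 : T.take (j + 1) <+: T.take (k + 1) :=
          List.take_prefix_take_left (by omega)
        obtain ⟨s, hs⟩ := h1
        refine ⟨s, ?_⟩
        rw [← hs, ← ht, List.append_assoc, ← htl, List.drop_left]
    · left
      refine ⟨T[k], by simp [List.getElem?_eq_getElem hk'], ?_⟩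
      rwa [← List.map_take, hfl]
  · intro k f hf hnf
    rw [List.getElem?_map, Option.map_eq_some_iff] at hf
    obtain ⟨a, hka, rfl⟩ := hf
    have ha : a ∈ T.take k := by
      by_contra h
      exact hnf ⟨a, by simp [hka], by rwa [← List.map_take, hfl]⟩
    obtain ⟨j, hj, hs⟩ := key k a hka ha
    exact ⟨j + 1, by omega, by omega, by rwa [← List.map_take, hfl]⟩

theorem lzEndOpt_le_length {α : Type*} (T : List α) : lzEndOpt T ≤ T.length :=
  Nat.sInf_le ⟨_, isLZEndFactorization_singletons T, by simp⟩

/-- The additive sensitivity of `lzEndOpt` is a maximum, as soon as there is a string to edit. -/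
theorem isGreatest_additiveSensitivity {α : Type*} (e : EditType) (n : ℕ)
    (hne : (sensitivitySet e (lzEndOpt (α := α)) n).Nonempty) :
    IsGreatest (sensitivitySet e (lzEndOpt (α := α)) n)
      (additiveSensitivity e (lzEndOpt (α := α)) n) := by
  have hb : BddAbove (sensitivitySet e (lzEndOpt (α := α)) n) := by
    refine ⟨(n : ℤ) + 1, ?_⟩
    rintro d ⟨T, T', -, hm, -, rfl⟩
    have h := lzEndOpt_le_length T'
    have h' : T'.length ≤ n + 1 := by
      cases e <;> simp only [EditType.LengthRel] at hm <;> omega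
    omega
  exact ⟨Int.csSup_mem hne hb, fun d hd => le_csSup hb hd⟩

/-! The LZ-End condition is first reduced to `IsEndParsing`: any single character is allowed as a
phrase, since the first occurrence of a character is always a phrase of its own and so creates a
boundary from which later occurrences can be copied.

Upper bound. Take an optimal parsing of `A ++ x ++ B` and repair it for `A ++ y ++ B`. A boundary is
forced at the edit, which requires re-parsing the part of the interrupted phrase lying before it;
`exists_cover` does this with O(√n) phrases. After the edit a phrase can be kept unless its source
contains the edit position, in which case it has the form `u ++ x ++ R` with `u` a suffix of `A` and
`R` a prefix of `B`. It is then determined by the pair of lengths of `u` and `R`. At the first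
occurrence of a pair the phrase is cut into `u`, `x`, `R`; later occurrences copy the first one
(`exists_transfers_append`). The pairs used are distinct and their entries have total sum at most n,
so there are O(n^{2/3}) of them (`card_le_of_sum_le`).

Lower bound. Saturate that count: surround `x` by `m` distinct characters on each side, then list
the m² words around `x`, separated by new characters. Each word is one phrase before the edit. After
the edit none of them occurs in the initial part, and in lexicographic order none occurs in an
earlier one, so each takes at least two (`exists_lzEndOpt_add_le`). The length is O(m³) and the gain
about m². -/

/-- The concatenations of the first phrases of `F`, that is, the prefixes of `F.flatten` that end
at a phrase boundary. -/
def boundaryPrefixes {α : Type*} (F : List (List α)) : Set (List α) :=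
  {P | ∃ H, H <+: F ∧ H.flatten = P}

/-- `f` can follow the phrases `F`: it is a single character or has a source ending at a
boundary of `F`. -/
def IsEndPhrase {α : Type*} (F : List (List α)) (f : List α) : Prop :=
  f ≠ [] ∧ (f.length = 1 ∨ ∃ P ∈ boundaryPrefixes F, f <:+ P)

/-- Every phrase is a single character or has a source ending at an earlier phrase boundary. -/
def IsEndParsing {α : Type*} (F : List (List α)) : Prop :=
  ∀ G f, G ++ [f] <+: F → IsEndPhrase G f

/-! ### Parsings whose sources end at phrase boundaries -/

section Parsing

variable {α : Type*} {F G H : List (List α)} {f P : List α}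

theorem flatten_prefix_flatten (h : G <+: F) : G.flatten <+: F.flatten := by
  obtain ⟨K, rfl⟩ := h
  simp

theorem boundaryPrefixes_mono (h : G <+: F) : boundaryPrefixes G ⊆ boundaryPrefixes F := by
  rintro P ⟨H, hH, rfl⟩
  exact ⟨H, hH.trans h, rfl⟩

theorem flatten_mem_boundaryPrefixes (h : G <+: F) : G.flatten ∈ boundaryPrefixes F :=
  ⟨G, h, rfl⟩

theorem prefix_of_mem_boundaryPrefixes (h : P ∈ boundaryPrefixes F) : P <+: F.flatten := by
  obtain ⟨H, hH, rfl⟩ := h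
  exact flatten_prefix_flatten hH

theorem mem_boundaryPrefixes_concat (h : P ∈ boundaryPrefixes (F ++ [f])) :
    P ∈ boundaryPrefixes F ∨ P = F.flatten ++ f := by
  obtain ⟨H, hH, rfl⟩ := h
  rcases List.prefix_concat_iff.1 hH with rfl | hH
  · right; simp
  · exact Or.inl ⟨H, hH, rfl⟩

theorem IsEndPhrase.mono (h : IsEndPhrase G f) (hG : G <+: F) : IsEndPhrase F f := by
  refine ⟨h.1, h.2.imp_right ?_⟩
  rintro ⟨P, hP, hf⟩
  exact ⟨P, boundaryPrefixes_mono hG hP, hf⟩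

theorem IsEndParsing.of_prefix (hF : IsEndParsing F) (h : G <+: F) : IsEndParsing G :=
  fun K f hK => hF K f (hK.trans h)

theorem IsEndParsing.nil : IsEndParsing ([] : List (List α)) := by
  intro G f h
  simp at h

theorem isEndParsing_concat_iff :
    IsEndParsing (F ++ [f]) ↔ IsEndParsing F ∧ IsEndPhrase F f := by
  constructor
  · intro h
    exact ⟨h.of_prefix (List.prefix_append _ _), h F f List.prefix_rfl⟩
  · rintro ⟨hF, hf⟩ G g hG
    rcases List.prefix_concat_iff.1 hG with h | h
    · obtain ⟨rfl, h⟩ := List.append_inj' h rfl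
      simp at h
      exact h ▸ hf
    · exact hF G g h

theorem IsEndParsing.append (hF : IsEndParsing F) (hG : ∀ g ∈ G, IsEndPhrase F g) :
    IsEndParsing (F ++ G) := by
  induction G using List.reverseRecOn with
  | nil => simpa
  | append_singleton G g ih =>
    rw [← List.append_assoc, isEndParsing_concat_iff]
    exact ⟨ih fun g' hg' => hG g' (by simp [hg']),
      (hG g (by simp)).mono (List.prefix_append _ _)⟩

/-- The non-empty members of `G` may be appended to a parsing if they are valid phrases. -/
theorem IsEndParsing.append_filter (hF : IsEndParsing F)
    (hG : ∀ g ∈ G, g ≠ [] → IsEndPhrase F g) :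
    IsEndParsing (F ++ G.filter fun l => !l.isEmpty) := by
  refine hF.append fun g hg => ?_
  simp only [List.mem_filter, Bool.not_eq_eq_eq_not, Bool.not_true, List.isEmpty_eq_false_iff] at hg
  exact hG g hg.1 hg.2

/-- The first occurrence of a character is a phrase of its own. -/
theorem IsEndParsing.exists_eq_of_not_mem (hF : IsEndParsing F) {X Y : List α} {c : α}
    (h : F.flatten = X ++ c :: Y) (hc : c ∉ X) :
    ∃ F₁ F₂, F = F₁ ++ [c] :: F₂ ∧ F₁.flatten = X ∧ F₂.flatten = Y := by
  induction F using List.reverseRecOn generalizing Y with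
  | nil => simp at h
  | append_singleton F f ih =>
    obtain ⟨hF, hf⟩ := isEndParsing_concat_iff.1 hF
    rw [List.flatten_concat] at h
    rcases List.append_eq_append_iff.1 h with ⟨Z, rfl, hZ⟩ | ⟨Z, hZ, hZ'⟩
    · have hcF : c ∉ F.flatten := fun h' => hc (by simp [h'])
      have hcf : c ∈ f := by simp [hZ]
      rcases hf.2 with h1 | ⟨P, hP, hfP⟩
      · obtain ⟨a, rfl⟩ := List.length_eq_one_iff.1 h1
        obtain rfl : c = a := by simpa using hcf
        have : Z = [] ∧ Y = [] := by
          have := congrArg List.length hZ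
          simp at this
          constructor <;> apply List.eq_nil_of_length_eq_zero <;> omega
        obtain ⟨rfl, rfl⟩ := this
        exact ⟨F, [], by simp⟩
      · exact absurd ((prefix_of_mem_boundaryPrefixes hP).subset (hfP.subset hcf)) hcF
    · cases Z with
      | nil =>
        simp at hZ hZ'
        rcases hf.2 with h1 | ⟨P, hP, hfP⟩
        · obtain ⟨a, rfl⟩ := List.length_eq_one_iff.1 h1
          simp at hZ'
          obtain ⟨rfl, rfl⟩ := hZ'
          exact ⟨F, [], by simp [hZ]⟩
        · refine absurd ((prefix_of_mem_boundaryPrefixes hP).subset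
            (hfP.subset (a := c) (by simp [← hZ']))) (hZ ▸ hc)
      | cons a Z =>
        simp at hZ'
        obtain ⟨rfl, rfl⟩ := hZ'
        obtain ⟨F₁, F₂, rfl, h1, h2⟩ := ih hF hZ
        exact ⟨F₁, F₂ ++ [f], by simp, h1, by simp [h2]⟩

theorem concat_prefix_of_getElem? {k : ℕ} (h : F[k]? = some f) : F.take k ++ [f] <+: F := by
  have : F.take (k + 1) = F.take k ++ [f] := by rw [List.take_add_one, h]; rfl
  exact this ▸ List.take_prefix _ _

theorem IsLZEndFactorization.isEndParsing {T : List α} (h : IsLZEndFactorization T F) :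
    IsEndParsing F := by
  intro G f hG
  obtain ⟨K, rfl⟩ := hG
  have hk : (G ++ [f] ++ K)[G.length]? = some f := by simp
  refine ⟨h.ne_nil f (by simp), ?_⟩
  by_cases hfr : IsFreshPhrase (G ++ [f] ++ K) G.length
  · obtain ⟨a, ha, -⟩ := hfr
    left
    rw [hk] at ha
    simp at ha
    simp [ha]
  · obtain ⟨i, -, hi, hs⟩ := h.source_ends _ f hk hfr
    right
    refine ⟨_, flatten_mem_boundaryPrefixes (List.take_prefix i G), ?_⟩
    rwa [List.append_assoc, List.take_append_of_le_length hi] at hs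

/-- Only a one-character phrase that is not fresh needs an argument: the first occurrence of that
character is a separate phrase, so it ends at a boundary and serves as source. A source ending at an
earlier boundary automatically starts to the left of the phrase. -/
theorem IsEndParsing.isLZEndFactorization (hF : IsEndParsing F) :
    IsLZEndFactorization F.flatten F := by
  have key : ∀ k f, F[k]? = some f → ¬ IsFreshPhrase F k →
      ∃ h : ℕ, 1 ≤ h ∧ h ≤ k ∧ f <:+ (F.take h).flatten := by
    intro k f hk hfr
    have hkF : k < F.length := (List.getElem?_eq_some_iff.1 hk).1
    have hpre := concat_prefix_of_getElem? hk
    obtain ⟨hne, hf⟩ := hF _ _ hpre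
    obtain ⟨P, ⟨H, hH, rfl⟩, hfP⟩ : ∃ P ∈ boundaryPrefixes (F.take k), f <:+ P := by
      rcases hf with h1 | h
      · obtain ⟨a, rfl⟩ := List.length_eq_one_iff.1 h1
        have ha : a ∈ (F.take k).flatten := by
          by_contra ha
          exact hfr ⟨a, hk, ha⟩
        obtain ⟨X, Y, hXY, haX⟩ := List.eq_append_cons_of_mem ha
        obtain ⟨F₁, F₂, hF', -, -⟩ :=
          (hF.of_prefix (List.take_prefix k F)).exists_eq_of_not_mem hXY haX
        refine ⟨_, flatten_mem_boundaryPrefixes (G := F₁ ++ [[a]]) ⟨F₂, by simp [hF']⟩, ?_⟩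
        simp
      · exact h
    have hHk : H.length ≤ k := by
      have := hH.length_le
      simp at this
      omega
    have hHt : F.take H.length = H := by
      have h1 := List.prefix_iff_eq_take.1 (hH.trans (List.take_prefix k F))
      exact h1.symm
    refine ⟨H.length, ?_, hHk, hHt.symm ▸ hfP⟩
    rw [Nat.one_le_iff_ne_zero]
    intro h0
    obtain rfl := List.eq_nil_of_length_eq_zero h0
    simp at hfP
    exact hne hfP
  refine ⟨⟨rfl, ?_, ?_⟩, key⟩
  · intro f hf
    obtain ⟨k, hk⟩ := List.getElem?_of_mem hf
    exact (hF _ _ (concat_prefix_of_getElem? hk)).1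
  · intro k hk
    rw [or_iff_not_imp_left]
    intro hfr
    have hk' := List.getElem?_eq_getElem hk
    obtain ⟨h, -, hhk, t, ht⟩ := key k _ hk' hfr
    have h1 := (hF _ _ (concat_prefix_of_getElem? hk')).1
    have h2 := (flatten_prefix_flatten (List.take_prefix_take_left (l := F) hhk))
    have h3 := (flatten_prefix_flatten
      (List.take_prefix_take_left (l := F) (show h ≤ k + 1 by omega)))
    refine ⟨_, hk', t.length, ?_, ?_⟩
    · have h4 := h2.length_le
      rw [← ht, List.length_append] at h4
      have := List.length_pos_iff.2 h1
      omega
    · obtain ⟨s, hs⟩ := h3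
      rw [← hs, ← ht, List.append_assoc, List.drop_left]
      exact List.prefix_append _ _

theorem IsEndParsing.lzEndOpt_le (hF : IsEndParsing F) : lzEndOpt F.flatten ≤ F.length :=
  Nat.sInf_le ⟨F, hF.isLZEndFactorization, rfl⟩

theorem exists_isEndParsing_length_eq (T : List α) :
    ∃ F, IsEndParsing F ∧ F.flatten = T ∧ F.length = lzEndOpt T := by
  obtain ⟨F, hF, hl⟩ := Nat.sInf_mem
    (s := {z : ℕ | ∃ fs : List (List α), IsLZEndFactorization T fs ∧ fs.length = z})
    ⟨_, _, isLZEndFactorization_singletons T, rfl⟩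
  exact ⟨F, hF.isEndParsing, hF.flatten_eq, hl⟩

/-! ### Covering an arbitrary substring by few phrases -/

/-- A proper prefix of `F.flatten` ends inside some phrase, possibly at its very start. -/
theorem exists_concat_prefix_of_prefix_flatten (hP : P <+: F.flatten) (hne : P ≠ F.flatten) :
    ∃ G u v, G ++ [u ++ v] <+: F ∧ P = G.flatten ++ u ∧ v ≠ [] := by
  induction F generalizing P with
  | nil => simp at hP hne; exact absurd hP hne
  | cons f F ih =>
    rw [List.flatten_cons] at hP hne
    obtain ⟨s, hs⟩ := hP
    rcases List.append_eq_append_iff.1 hs with ⟨Z, hZ, hZ'⟩ | ⟨Z, hZ, hZ'⟩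
    · cases Z with
      | nil =>
        simp at hZ
        subst hZ
        have hn : ([] : List α) ≠ F.flatten := fun h => hne (by simp [← h])
        obtain ⟨G, u, v, hG, hu, hv⟩ := ih (List.nil_prefix) hn
        refine ⟨f :: G, u, v, by simpa using hG, ?_, hv⟩
        simp [List.append_assoc, ← hu]
      | cons a Z => exact ⟨[], P, a :: Z, by simp [hZ], by simp, by simp⟩
    · subst hZ
      obtain ⟨G, u, v, hG, hu, hv⟩ := ih (P := Z) ⟨s, hZ'.symm⟩ (fun h => hne (by rw [h]))
      exact ⟨f :: G, u, v, by simpa using hG, by simp [hu], hv⟩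

theorem suffix_of_append_suffix_append {u w t : List α} (h : w ++ u <:+ t ++ u) : w <:+ t := by
  obtain ⟨s, hs⟩ := h
  exact ⟨s, List.append_cancel_right (bs := u) (by simpa using hs)⟩

/-- A substring that ends at position `|P|` is a concatenation of `r` valid phrases, where
`r (r - 1) ≤ 2 |P|`. -/
theorem IsEndParsing.exists_cover (hF : IsEndParsing F) :
    ∀ P, P <+: F.flatten → ∀ u, u <:+ P → ∃ Gs : List (List α), Gs.flatten = u ∧
      (∀ g ∈ Gs, IsEndPhrase F g) ∧ Gs.length * Gs.length ≤ 2 * P.length + Gs.length := by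
  have base : ∀ P ∈ boundaryPrefixes F, ∀ u, u <:+ P → ∃ Gs : List (List α), Gs.flatten = u ∧
      (∀ g ∈ Gs, IsEndPhrase F g) ∧ Gs.length * Gs.length ≤ 2 * P.length + Gs.length := by
    intro P hP u hu
    by_cases h0 : u = []
    · exact ⟨[], by simp [h0]⟩
    · exact ⟨[u], by simp, by simpa using ⟨h0, Or.inr ⟨P, hP, hu⟩⟩, by simp⟩
  intro P
  induction hn : P.length using Nat.strong_induction_on generalizing P with
  | _ n ih =>
  subst hn
  intro hP u hu
  by_cases hPF : P = F.flatten
  · exact base P (hPF ▸ flatten_mem_boundaryPrefixes List.prefix_rfl) u hu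
  obtain ⟨G, u', v, hG, rfl, hv⟩ := exists_concat_prefix_of_prefix_flatten hP hPF
  have hGF : G <+: F := (List.prefix_append _ _).trans hG
  by_cases hu' : u' = []
  · subst hu'
    exact base _ (by simpa using flatten_mem_boundaryPrefixes hGF) u hu
  have hul := List.length_pos_iff.2 hu'
  have hvl := List.length_pos_iff.2 hv
  -- The end of `P` cuts this phrase into two non-empty parts, so the phrase is not a single
  -- character and must be a copy. Following the copy replaces `P` by the shorter prefix `t ++ u'`.
  obtain ⟨Q, hQ, t, ht⟩ : ∃ Q ∈ boundaryPrefixes G, u' ++ v <:+ Q := by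
    rcases (hF G _ hG).2 with h | h
    · rw [List.length_append] at h
      omega
    · exact h
  have hQG := prefix_of_mem_boundaryPrefixes hQ
  have hlen : t.length + u'.length + v.length ≤ G.flatten.length := by
    have := hQG.length_le
    rw [← ht] at this
    simp only [List.length_append] at this
    omega
  have hPQ : t ++ u' <+: F.flatten :=
    (List.IsPrefix.trans ⟨v, by simpa using ht⟩ hQG).trans (flatten_prefix_flatten hGF)
  have IH := ih (t ++ u').length (by simp only [List.length_append]; omega) (t ++ u') rfl hPQ
  rcases List.suffix_or_suffix_of_suffix hu (List.suffix_append G.flatten u') with h | ⟨w, rfl⟩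
  · obtain ⟨Gs, h1, h2, h3⟩ := IH u (h.trans (List.suffix_append _ _))
    refine ⟨Gs, h1, h2, h3.trans ?_⟩
    simp only [List.length_append]
    omega
  · have hw := suffix_of_append_suffix_append hu
    obtain ⟨Gs, h1, h2, h3⟩ := IH u' (List.suffix_append _ _)
    -- With r phrases for `u'`, adding `w` raises r(r - 1) by 2r, at most twice the length of `u'`.
    -- This is paid for because `P` exceeds `t ++ u'` in length by more than the length of `u'`.
    have hGs : Gs.length ≤ u'.length := by
      rw [← h1, List.length_flatten]
      have := List.card_nsmul_le_sum (Gs.map List.length) 1 (by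
        intro x hx
        obtain ⟨g, hg, rfl⟩ := List.mem_map.1 hx
        exact List.length_pos_iff.2 (h2 g hg).1)
      simpa using this
    simp only [List.length_append] at h3 ⊢
    by_cases hw0 : w = []
    · exact ⟨Gs, by simp [h1, hw0], h2, by omega⟩
    · refine ⟨w :: Gs, by simp [h1], ?_, ?_⟩
      · intro g hg
        rcases List.mem_cons.1 hg with rfl | hg
        · exact ⟨hw0, Or.inr ⟨_, flatten_mem_boundaryPrefixes hGF, hw⟩⟩
        · exact h2 g hg
      · simp only [List.length_cons]
        nlinarith

end Parsing

/-! ### Upper bound: repairing a parsing after an edit -/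

section Upper

variable {α : Type*} {A x y B B' : List α} {J G G' : List (List α)} {f : List α}

/-- Every boundary of the parsing `J` of a prefix of `A ++ x ++ B` outside `x` is a boundary of the
parsing `G` of the corresponding prefix of `A ++ y ++ B`. -/
structure TransfersBoundaries (A x y : List α) (J G : List (List α)) : Prop where
  edit : A ∈ boundaryPrefixes G
  left : ∀ P ∈ boundaryPrefixes J, P.length ≤ A.length → P ∈ boundaryPrefixes G
  right : ∀ R, A ++ x ++ R ∈ boundaryPrefixes J → A ++ y ++ R ∈ boundaryPrefixes G

theorem TransfersBoundaries.concat (h : TransfersBoundaries A x y J G) (hf : f ≠ [])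
    (hJ : J.flatten = A ++ x ++ B) (hG : G <+: G') (hG' : G'.flatten = A ++ y ++ (B ++ f)) :
    TransfersBoundaries A x y (J ++ [f]) G' := by
  have hfl := List.length_pos_iff.2 hf
  refine ⟨boundaryPrefixes_mono hG h.edit, ?_, ?_⟩
  · intro P hP hl
    rcases mem_boundaryPrefixes_concat hP with hP | rfl
    · exact boundaryPrefixes_mono hG (h.left P hP hl)
    · simp only [hJ, List.length_append] at hl
      omega
  · intro R hR
    rcases mem_boundaryPrefixes_concat hR with hR | hR
    · exact boundaryPrefixes_mono hG (h.right R hR)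
    · rw [hJ, List.append_assoc (A ++ x)] at hR
      obtain rfl := List.append_cancel_left hR
      exact hG' ▸ flatten_mem_boundaryPrefixes List.prefix_rfl

/-- The substring of `A ++ x ++ B` that extends `x` by `p.1` characters to the left and by `p.2`
characters to the right. -/
def crossingWord (A x B : List α) (p : ℕ × ℕ) : List α :=
  A.drop (A.length - p.1) ++ x ++ B.take p.2

theorem crossingWord_length {u R : List α} (hu : u <:+ A) (hR : R <+: B) :
    crossingWord A x B (u.length, R.length) = u ++ x ++ R := by
  rw [crossingWord, ← List.suffix_iff_eq_drop.1 hu, ← List.prefix_iff_eq_take.1 hR]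

theorem length_filter_isEmpty_le (Gs : List (List α)) :
    (Gs.filter fun l => !l.isEmpty).length ≤ Gs.length :=
  List.length_filter_le _ _

/-- Parsing `A ++ y` and the rest of the phrase of `J ++ [f]` that meets the edit. -/
theorem exists_transfers_of_phrase {u v w : List α} (hf : IsEndParsing (J ++ [u ++ v]))
    (hA : A = J.flatten ++ u) (hv : v ≠ []) (hw : v = x ++ w) (hx : x.length ≤ 1)
    (hy : y.length ≤ 1) :
    ∃ (G : List (List α)) (r : ℕ), IsEndParsing G ∧ G.flatten = A ++ y ++ w ∧
      TransfersBoundaries A x y (J ++ [u ++ v]) G ∧ r * r ≤ 2 * A.length + r ∧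
      G.length ≤ J.length + r + 2 := by
  obtain ⟨hJ, hphr⟩ := isEndParsing_concat_iff.1 hf
  have hvl := List.length_pos_iff.2 hv
  obtain ⟨Gs, hGs, hGsv, hr⟩ : ∃ Gs : List (List α), Gs.flatten = u ∧
      (∀ g ∈ Gs, IsEndPhrase J g) ∧ Gs.length * Gs.length ≤ 2 * A.length + Gs.length := by
    -- Only the sources available in `J` may be used for `u`; the source of the whole phrase gives
    -- an occurrence of `u` inside `J.flatten`, to which the covering lemma applies.
    rcases hphr.2 with h1 | ⟨Q, hQ, t, ht⟩
    · have : u = [] := by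
        apply List.eq_nil_of_length_eq_zero
        rw [List.length_append] at h1
        omega
      exact ⟨[], by simp [this]⟩
    · have hQJ := prefix_of_mem_boundaryPrefixes hQ
      have hP : t ++ u <+: J.flatten := List.IsPrefix.trans ⟨v, by simpa using ht⟩ hQJ
      obtain ⟨Gs, h1, h2, h3⟩ := hJ.exists_cover _ hP u (List.suffix_append _ _)
      refine ⟨Gs, h1, h2, h3.trans ?_⟩
      have := hP.length_le
      rw [hA, List.length_append (as := J.flatten)]
      omega
  have hone : ∀ z : List α, z.length ≤ 1 → z ≠ [] → IsEndPhrase J z := by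
    intro z hz hz0
    have := List.length_pos_iff.2 hz0
    exact ⟨hz0, Or.inl (by omega)⟩
  have hwv : w ≠ [] → IsEndPhrase J w := by
    intro hw0
    refine ⟨hw0, ?_⟩
    rcases hphr.2 with h1 | ⟨Q, hQ, hs⟩
    · left
      have := List.length_pos_iff.2 hw0
      simp only [hw, List.length_append] at h1
      omega
    · right
      exact ⟨Q, hQ, List.IsSuffix.trans ⟨u ++ x, by simp [hw]⟩ hs⟩
  have hsplit : J ++ (Gs ++ [y, w]).filter (fun l => !l.isEmpty) =
      J ++ Gs.filter (fun l => !l.isEmpty) ++ [y].filter (fun l => !l.isEmpty) ++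
        [w].filter (fun l => !l.isEmpty) := by
    rw [show Gs ++ [y, w] = Gs ++ [y] ++ [w] by simp, List.filter_append, List.filter_append]
    simp only [List.append_assoc]
  have hflat : (J ++ (Gs ++ [y, w]).filter (fun l => !l.isEmpty)).flatten = A ++ y ++ w := by
    rw [List.flatten_append, List.flatten_filter_not_isEmpty]
    simp [hGs, hA]
  refine ⟨J ++ (Gs ++ [y, w]).filter fun l => !l.isEmpty, Gs.length, ?_, hflat, ?_, hr, ?_⟩
  · refine hJ.append_filter ?_
    intro g hg hg0
    simp only [List.mem_append, List.mem_cons, List.not_mem_nil, or_false] at hg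
    rcases hg with hg | rfl | rfl
    · exact hGsv g hg
    · exact hone _ hy hg0
    · exact hwv hg0
  · have hpA : A ∈ boundaryPrefixes (J ++ (Gs ++ [y, w]).filter (fun l => !l.isEmpty)) := by
      refine ⟨J ++ Gs.filter (fun l => !l.isEmpty), ?_, ?_⟩
      · rw [hsplit, List.append_assoc]
        exact List.prefix_append _ _
      · rw [List.flatten_append, List.flatten_filter_not_isEmpty, hGs, hA]
    refine ⟨hpA, ?_, ?_⟩
    · intro P hP hl
      rcases mem_boundaryPrefixes_concat hP with hP | rfl
      · exact boundaryPrefixes_mono (List.prefix_append _ _) hP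
      · simp only [hA, List.length_append] at hl
        omega
    · intro R hR
      rcases mem_boundaryPrefixes_concat hR with hR | hR
      · have hl := (prefix_of_mem_boundaryPrefixes hR).length_le
        -- A boundary of `J` can reach the edit only for an insertion at the start of a phrase; its
        -- counterpart is the boundary right after `y`.
        have : x.length = 0 ∧ R.length = 0 := by
          simp only [hA, List.length_append] at hl
          omega
        obtain rfl := List.eq_nil_of_length_eq_zero this.2
        refine ⟨J ++ Gs.filter (fun l => !l.isEmpty) ++ [y].filter (fun l => !l.isEmpty), ?_, ?_⟩
        · rw [hsplit]
          exact List.prefix_append _ _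
        · rw [List.flatten_append, List.flatten_append, List.flatten_filter_not_isEmpty,
            List.flatten_filter_not_isEmpty, hGs, hA]
          simp
      · have : R = w := by
          rw [hA, hw] at hR
          simpa using hR
        subst this
        exact hflat ▸ flatten_mem_boundaryPrefixes List.prefix_rfl
  · have := length_filter_isEmpty_le (Gs ++ [y, w])
    simp only [List.length_append, List.length_cons, List.length_nil] at this ⊢
    omega

/-- Translating the phrases after the edit: each phrase whose source meets the edit is split into
three the first time it occurs. -/
theorem exists_transfers_append {K : List (List α)} (hx : x.length ≤ 1)
    (hG : IsEndParsing G) {w : List α} (hJw : J.flatten = A ++ x ++ w)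
    (hGw : G.flatten = A ++ y ++ w) (hJG : TransfersBoundaries A x y J G) :
    ∀ B', IsEndParsing (J ++ K) → (J ++ K).flatten = A ++ x ++ B' → B' <+: B →
    ∃ (G' : List (List α)) (D : Finset (ℕ × ℕ)), IsEndParsing G' ∧
      G'.flatten = A ++ y ++ B' ∧ TransfersBoundaries A x y (J ++ K) G' ∧
      ∑ p ∈ D, (p.1 + p.2) ≤ K.flatten.length ∧
      (∀ p ∈ D, ∃ P ∈ boundaryPrefixes G', crossingWord A x B p <:+ P) ∧
      G'.length ≤ G.length + K.length + 2 * D.card := by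
  induction K using List.reverseRecOn with
  | nil =>
    intro B' _ hB' _
    obtain rfl : w = B' := by
      rw [List.append_nil, hJw] at hB'
      exact List.append_cancel_left hB'
    exact ⟨G, ∅, hG, hGw, by simpa using hJG, by simp, by simp, by simp⟩
  | append_singleton K f ih =>
    intro B'' hJK hfl hB''
    rw [← List.append_assoc] at hJK hfl ⊢
    obtain ⟨hJK', hphr⟩ := isEndParsing_concat_iff.1 hJK
    obtain ⟨B', hB'⟩ : ∃ B', (J ++ K).flatten = A ++ x ++ B' := ⟨w ++ K.flatten, by simp [hJw]⟩
    obtain rfl : B'' = B' ++ f := by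
      rw [List.flatten_concat, hB', List.append_assoc] at hfl
      exact (List.append_cancel_left hfl).symm
    have hB'B := (List.prefix_append B' f).trans hB''
    obtain ⟨G', D, hG', hfl', htr, hD, hDw, hlen⟩ := ih B' hJK' hB' hB'B
    have single : IsEndPhrase G' f → ∃ (G' : List (List α)) (D : Finset (ℕ × ℕ)),
        IsEndParsing G' ∧ G'.flatten = A ++ y ++ (B' ++ f) ∧
        TransfersBoundaries A x y (J ++ K ++ [f]) G' ∧
        ∑ p ∈ D, (p.1 + p.2) ≤ (K ++ [f]).flatten.length ∧
        (∀ p ∈ D, ∃ P ∈ boundaryPrefixes G', crossingWord A x B p <:+ P) ∧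
        G'.length ≤ G.length + (K ++ [f]).length + 2 * D.card := by
      intro hf
      have hflat : (G' ++ [f]).flatten = A ++ y ++ (B' ++ f) := by simp [hfl']
      refine ⟨G' ++ [f], D, isEndParsing_concat_iff.2 ⟨hG', hf⟩, hflat,
        htr.concat hphr.1 hB' (List.prefix_append _ _) hflat, ?_, ?_, ?_⟩
      · simp only [List.flatten_concat, List.length_append]
        omega
      · intro p hp
        obtain ⟨P, hP, h⟩ := hDw p hp
        exact ⟨P, boundaryPrefixes_mono (List.prefix_append _ _) hP, h⟩
      · simp only [List.length_append, List.length_singleton]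
        omega
    rcases hphr.2 with h1 | ⟨P, hP, hfP⟩
    · exact single ⟨hphr.1, Or.inl h1⟩
    by_cases hPA : P.length ≤ A.length
    · exact single ⟨hphr.1, Or.inr ⟨P, htr.left P hP hPA, hfP⟩⟩
    have hPJ := prefix_of_mem_boundaryPrefixes hP
    obtain ⟨R, rfl⟩ : A ++ x <+: P := by
      refine List.prefix_of_prefix_length_le (l₃ := (J ++ K).flatten) ?_ hPJ ?_
      · rw [hB']
        exact List.prefix_append _ _
      · rw [List.length_append]
        omega
    have hRB' : R <+: B' := by
      rw [hB'] at hPJ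
      exact (List.prefix_append_right_inj _).1 hPJ
    have hRG := htr.right R hP
    rcases List.suffix_or_suffix_of_suffix hfP (List.suffix_append (A ++ x) R) with
      hfR | ⟨s, rfl⟩
    · exact single ⟨hphr.1, Or.inr ⟨_, hRG, hfR.trans (List.suffix_append _ _)⟩⟩
    have hs := suffix_of_append_suffix_append hfP
    -- As `x` has at most one character, a suffix `s` of `A ++ x` that does not contain this final
    -- `x` is empty.
    by_cases hsx : s.length ≤ x.length ∧ s ≠ x
    · have hs0 : s = [] := by
        apply List.eq_nil_of_length_eq_zero
        by_contra h0
        refine hsx.2 ?_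
        have := List.suffix_of_suffix_length_le hs (List.suffix_append A x) hsx.1
        exact this.eq_of_length (by omega)
      subst hs0
      exact single ⟨hphr.1, Or.inr ⟨_, hRG, List.suffix_append _ _⟩⟩
    obtain ⟨u, rfl⟩ : x <:+ s := by
      rw [not_and_not_right] at hsx
      rcases le_total s.length x.length with h | h
      · rw [hsx h]
      · exact List.suffix_of_suffix_length_le (List.suffix_append A x) hs h
    have hu := suffix_of_append_suffix_append hs
    have hword : crossingWord A x B (u.length, R.length) = u ++ x ++ R :=
      crossingWord_length hu (hRB'.trans hB'B)
    -- A pair in `D` was split before, and the three pieces ended at a boundary, so the whole word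
    -- can be copied from there.
    by_cases hp : (u.length, R.length) ∈ D
    · obtain ⟨P, hP, h⟩ := hDw _ hp
      exact single ⟨hphr.1, Or.inr ⟨P, hP, hword ▸ h⟩⟩
    have hflat : (G' ++ [u, x, R].filter fun l => !l.isEmpty).flatten =
        A ++ y ++ (B' ++ (u ++ x ++ R)) := by
      rw [List.flatten_append, List.flatten_filter_not_isEmpty, hfl']
      simp
    refine ⟨G' ++ [u, x, R].filter fun l => !l.isEmpty, insert (u.length, R.length) D,
      hG'.append_filter ?_, hflat,
      htr.concat hphr.1 hB' (List.prefix_append _ _) hflat, ?_, ?_, ?_⟩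
    · intro g hg hg0
      simp only [List.mem_cons, List.not_mem_nil, or_false] at hg
      rcases hg with rfl | rfl | rfl
      · exact ⟨hg0, Or.inr ⟨A, htr.edit, hu⟩⟩
      · have := List.length_pos_iff.2 hg0
        exact ⟨hg0, Or.inl (by omega)⟩
      · exact ⟨hg0, Or.inr ⟨_, hRG, List.suffix_append _ _⟩⟩
    -- A new pair is charged to the length of its own phrase `u ++ x ++ R`; these phrases are
    -- disjoint.
    · rw [Finset.sum_insert hp]
      simp only [List.flatten_concat, List.length_append]
      omega
    · intro p hpD
      rcases Finset.mem_insert.1 hpD with rfl | hpD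
      · refine ⟨_, flatten_mem_boundaryPrefixes List.prefix_rfl, ?_⟩
        rw [hflat, hword]
        exact ⟨A ++ y ++ B', by simp⟩
      · obtain ⟨P, hP, h⟩ := hDw p hpD
        exact ⟨P, boundaryPrefixes_mono (List.prefix_append _ _) hP, h⟩
    · have := length_filter_isEmpty_le [u, x, R]
      rw [Finset.card_insert_of_notMem hp]
      simp only [List.length_append, List.length_cons, List.length_nil] at this ⊢
      omega

/-- The phrase interrupted by the edit costs `r + 2` extra phrases, and every distinct crossing pair
two more. An edit at the very end only appends `y`. -/
theorem exists_isEndParsing_edit {F : List (List α)} (hF : IsEndParsing F)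
    (hfl : F.flatten = A ++ x ++ B) (hx : x.length ≤ 1) (hy : y.length ≤ 1) :
    ∃ (G : List (List α)) (r : ℕ) (D : Finset (ℕ × ℕ)), IsEndParsing G ∧
      G.flatten = A ++ y ++ B ∧ r * r ≤ 2 * F.flatten.length + r ∧
      ∑ p ∈ D, (p.1 + p.2) ≤ F.flatten.length ∧
      G.length ≤ F.length + r + 2 + 2 * D.card := by
  by_cases hAF : A = F.flatten
  · have h0 : x = [] ∧ B = [] := by
      rw [← hAF, List.append_assoc] at hfl
      simpa using hfl
    refine ⟨F ++ [y].filter fun l => !l.isEmpty, 0, ∅, hF.append_filter ?_, ?_, by simp, by simp,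
      ?_⟩
    · intro g hg hg0
      obtain rfl : g = y := by simpa using hg
      have := List.length_pos_iff.2 hg0
      exact ⟨hg0, Or.inl (by omega)⟩
    · rw [List.flatten_append, List.flatten_filter_not_isEmpty, ← hAF, h0.2]
      simp
    · have := length_filter_isEmpty_le [y]
      simp only [List.length_append, List.length_singleton] at this ⊢
      omega
  have hApre : A <+: F.flatten := by
    rw [hfl, List.append_assoc]
    exact List.prefix_append _ _
  obtain ⟨J, u, v, ⟨K, rfl⟩, hA, hv⟩ := exists_concat_prefix_of_prefix_flatten hApre hAF
  have hvl := List.length_pos_iff.2 hv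
  have hJflat : (J ++ [u ++ v]).flatten = A ++ v := by simp [hA]
  have hvK : v ++ K.flatten = x ++ B := by
    rw [List.flatten_append, hJflat, List.append_assoc, List.append_assoc] at hfl
    exact List.append_cancel_left hfl
  obtain ⟨w, hw⟩ : x <+: v :=
    List.prefix_of_prefix_length_le (List.prefix_append x B) (hvK ▸ List.prefix_append v _)
      (by omega)
  obtain ⟨G, r, hG, hGfl, htr, hr, hlen⟩ := exists_transfers_of_phrase
    (hF.of_prefix (List.prefix_append _ _)) hA hv hw.symm hx hy
  obtain ⟨G', D, hG', hfl', -, hD, -, hlen'⟩ := exists_transfers_append (K := K) (B := B) hx hG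
    (by rw [hJflat, ← hw, List.append_assoc]) hGfl htr B hF hfl List.prefix_rfl
  have hAl := hApre.length_le
  refine ⟨G', r, D, hG', hfl', by omega, hD.trans ?_, ?_⟩
  · rw [List.flatten_append, List.length_append]
    omega
  · simp only [List.length_append, List.length_singleton] at hlen hlen' ⊢
    omega

/-- Fewer than `L` choices per coordinate bound the pairs of sum below `L` by `L ^ 2`; each of the
others uses at least `L` of the total `n ≤ L ^ 3`. -/
theorem card_le_of_sum_le {D : Finset (ℕ × ℕ)} {n L : ℕ} (hD : ∑ p ∈ D, (p.1 + p.2) ≤ n)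
    (hL : n ≤ L ^ 3) (hL0 : 0 < L) : D.card ≤ 2 * L ^ 2 := by
  have h1 : (D.filter fun p => p.1 + p.2 < L).card ≤ L ^ 2 := by
    have : D.filter (fun p => p.1 + p.2 < L) ⊆ Finset.range L ×ˢ Finset.range L := by
      intro p hp
      simp only [Finset.mem_filter, Finset.mem_product, Finset.mem_range] at hp ⊢
      omega
    simpa [sq] using Finset.card_le_card this
  have h2 : (D.filter fun p => ¬ p.1 + p.2 < L).card ≤ L ^ 2 := by
    have h3 : (D.filter fun p => ¬ p.1 + p.2 < L).card * L ≤ n := by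
      refine le_trans ?_ ((Finset.sum_le_sum_of_subset
        (Finset.filter_subset (fun p => ¬ p.1 + p.2 < L) D)).trans hD)
      rw [← smul_eq_mul]
      exact Finset.card_nsmul_le_sum _ _ _ fun p hp => by simpa using (Finset.mem_filter.1 hp).2
    nlinarith
  have := Finset.card_filter_add_card_filter_not (s := D) (p := fun p => p.1 + p.2 < L)
  omega

theorem lzEndOpt_edit_le {n L : ℕ} (hn : (A ++ x ++ B).length ≤ n) (hL : n ≤ L ^ 3) (hL0 : 0 < L)
    (hx : x.length ≤ 1) (hy : y.length ≤ 1) :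
    lzEndOpt (A ++ y ++ B) ≤ lzEndOpt (A ++ x ++ B) + 9 * L ^ 2 := by
  obtain ⟨F, hF, hfl, hlen⟩ := exists_isEndParsing_length_eq (A ++ x ++ B)
  obtain ⟨G, r, D, hG, hGfl, hr, hD, hle⟩ := exists_isEndParsing_edit hF hfl hx hy
  have hGl := hG.lzEndOpt_le
  rw [hfl] at hr hD
  have hcard := card_le_of_sum_le (hD.trans hn) hL hL0
  -- In truth `r` is of order √n; this weaker bound is enough, and the total overhead is at most 6
  -- `L ^ 2` + 3, hence at most 9 `L ^ 2`.
  have hrL : r ≤ 2 * L ^ 2 + 1 := by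
    by_contra! h
    have h4 : L ^ 3 ≤ L ^ 4 := Nat.pow_le_pow_right hL0 (by norm_num)
    have h5 : r * r ≤ 2 * L ^ 4 + r := by omega
    have h6 : (2 * L ^ 2 + 1) * r ≤ (r - 1) * r := Nat.mul_le_mul_right _ (by omega)
    have h7 : (r - 1) * r + r = r * r := by
      obtain ⟨s, rfl⟩ := Nat.exists_eq_add_of_lt h
      simp only [Nat.add_sub_cancel]
      ring
    have h8 : (2 * L ^ 2 + 1) * (2 * L ^ 2 + 1) ≤ (2 * L ^ 2 + 1) * r :=
      Nat.mul_le_mul_left _ (by omega)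
    nlinarith
  rw [hGfl] at hGl
  have : 1 ≤ L ^ 2 := Nat.one_le_pow _ _ hL0
  omega

theorem SingleEdit.exists_append {e : EditType} {S T : List α} (h : SingleEdit e S T) :
    ∃ A x y B : List α, S = A ++ x ++ B ∧ T = A ++ y ++ B ∧ x.length ≤ 1 ∧ y.length ≤ 1 := by
  cases h with
  | sub u v a b => exact ⟨u, [a], [b], v, by simp⟩
  | ins u v b => exact ⟨u, [], [b], v, by simp⟩
  | del u v a => exact ⟨u, [a], [], v, by simp⟩

theorem additiveSensitivity_lzEndOpt_le (α : Type*) (e : EditType) {n : ℕ} (hn : 1 ≤ n) :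
    (additiveSensitivity e (lzEndOpt (α := α)) n : ℝ) ≤ 36 * (n : ℝ) ^ (2 / 3 : ℝ) := by
  have hn1 : (1 : ℝ) ≤ n := by exact_mod_cast hn
  have hn0 : (0 : ℝ) ≤ n := by linarith
  rcases (sensitivitySet e (lzEndOpt (α := α)) n).eq_empty_or_nonempty with h | h
  -- Over a small alphabet there may be no admissible edit; the supremum of the empty set is 0, as
  -- in the convention of the theorem.
  · rw [additiveSensitivity, h, Int.csSup_empty]
    simp only [Int.cast_zero]
    positivity
  obtain ⟨T, T', hT, hrel, hed, hd⟩ := (isGreatest_additiveSensitivity e n h).1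
  obtain ⟨A, x, y, B, rfl, rfl, hx, hy⟩ :=
    ((editDist_eq_one_iff e T T').1 ⟨hT ▸ hrel, hed⟩).exists_append
  set s : ℝ := (n : ℝ) ^ (1 / 3 : ℝ) with hs
  have hs1 : 1 ≤ s := Real.one_le_rpow hn1 (by norm_num)
  have hs3 : s ^ 3 = n := by
    rw [hs, ← Real.rpow_natCast, ← Real.rpow_mul hn0]
    norm_num
  have hs2 : (n : ℝ) ^ (2 / 3 : ℝ) = s ^ 2 := by
    rw [hs, ← Real.rpow_natCast, ← Real.rpow_mul hn0]
    norm_num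
  have hL1 := Nat.le_ceil s
  have hL2 := Nat.ceil_lt_add_one (show 0 ≤ s by linarith)
  have hL : n ≤ ⌈s⌉₊ ^ 3 := by
    have : (n : ℝ) ≤ (⌈s⌉₊ : ℝ) ^ 3 := hs3 ▸ pow_le_pow_left₀ (by linarith) hL1 3
    exact_mod_cast this
  have key := lzEndOpt_edit_le (y := y) hT.le hL (Nat.ceil_pos.2 (by linarith)) hx hy
  have key' : additiveSensitivity e (lzEndOpt (α := α)) n ≤ 9 * (⌈s⌉₊ : ℤ) ^ 2 := by
    rw [hd]
    have : (lzEndOpt (A ++ y ++ B) : ℤ) ≤ lzEndOpt (A ++ x ++ B) + 9 * (⌈s⌉₊ : ℤ) ^ 2 := by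
      exact_mod_cast key
    linarith
  have key'' : (additiveSensitivity e (lzEndOpt (α := α)) n : ℝ) ≤ 9 * (⌈s⌉₊ : ℝ) ^ 2 := by
    exact_mod_cast key'
  -- The rounded-up cube root is at most `2 * s` because `1 ≤ s`, which turns 9 into 36.
  rw [hs2]
  nlinarith

end Upper

/-! ### Lower bound: phrases forced by new characters and new substrings -/

section Lower

variable {α : Type*} {F : List (List α)} {S X Y Z W : List α} {c d : α}

theorem infix_left_or_right_of_not_mem (h : S <:+: X ++ c :: Y) (hc : c ∉ S) :
    S <:+: X ∨ S <:+: Y := by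
  obtain ⟨s, t, h⟩ := h
  rw [List.append_assoc] at h
  rcases List.append_eq_append_iff.1 h with ⟨Z, rfl, hZ⟩ | ⟨Z, rfl, hZ⟩
  · rcases List.append_eq_append_iff.1 hZ with ⟨V, rfl, -⟩ | ⟨V, rfl, hV⟩
    · exact Or.inl ⟨s, V, by simp⟩
    · cases V with
      | nil => exact Or.inl ⟨s, [], by simp⟩
      | cons a V =>
        simp only [List.cons_append, List.cons.injEq] at hV
        simp [hV.1] at hc
  · cases Z with
    | nil =>
      cases S with
      | nil => exact Or.inl List.nil_infix
      | cons a S =>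
        simp only [List.nil_append, List.cons_append, List.cons.injEq] at hZ
        simp [hZ.1] at hc
    | cons a Z =>
      simp only [List.cons_append, List.cons.injEq] at hZ
      exact Or.inr ⟨Z, t, by simp [hZ.2]⟩

theorem IsEndParsing.ne_nil (hF : IsEndParsing F) {f : List α} (hf : f ∈ F) : f ≠ [] := by
  obtain ⟨G, H, rfl⟩ := List.append_of_mem hf
  exact (hF G f ⟨H, by simp⟩).1

theorem IsEndParsing.exists_eq_concat (hF : IsEndParsing F) (h : F.flatten = X ++ [c])
    (hc : c ∉ X) : ∃ F₁, F = F₁ ++ [[c]] ∧ IsEndParsing F₁ ∧ F₁.flatten = X := by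
  obtain ⟨F₁, F₂, rfl, h1, h2⟩ := hF.exists_eq_of_not_mem h hc
  cases F₂ with
  | nil => exact ⟨F₁, rfl, hF.of_prefix (List.prefix_append _ _), h1⟩
  | cons f F₂ =>
    exact absurd (List.flatten_eq_nil_iff.1 h2 f (by simp)) (hF.ne_nil (by simp))

/-- Each new character at the end takes one more phrase. -/
theorem IsEndParsing.exists_length_add_le (hZ : Z.Nodup) (hXZ : ∀ c ∈ Z, c ∉ X) :
    ∀ {F : List (List α)}, IsEndParsing F → F.flatten = X ++ Z →
      ∃ F₁, IsEndParsing F₁ ∧ F₁.flatten = X ∧ F₁.length + Z.length ≤ F.length := by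
  induction Z using List.reverseRecOn with
  | nil => exact fun {F} hF h => ⟨F, hF, by simpa using h, by simp⟩
  | append_singleton Z c ih =>
    intro F hF h
    have hc : c ∉ Z := by
      rw [← List.concat_eq_append, List.nodup_concat] at hZ
      exact hZ.1
    rw [← List.append_assoc] at h
    obtain ⟨F', rfl, hF', hfl⟩ := hF.exists_eq_concat h (by simp [hc, hXZ c])
    obtain ⟨F₁, h1, h2, h3⟩ := ih (hZ.sublist (List.sublist_append_left _ _))
      (fun a ha => hXZ a (by simp [ha])) hF' hfl
    refine ⟨F₁, h1, h2, ?_⟩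
    simp only [List.length_append, List.length_singleton]
    omega

theorem IsEndParsing.append_singletons (hF : IsEndParsing F) (Z : List α) :
    IsEndParsing (F ++ Z.map fun a => [a]) := by
  refine hF.append fun g hg => ?_
  obtain ⟨a, -, rfl⟩ := List.mem_map.1 hg
  exact ⟨by simp, Or.inl rfl⟩

theorem flatten_map_singleton (Z : List α) : (Z.map fun a => [a]).flatten = Z := by
  induction Z with
  | nil => rfl
  | cons a Z ih => simp [ih]

/-- A new substring between two first occurrences of characters takes two phrases. -/
theorem IsEndParsing.exists_length_add_three_le (hF : IsEndParsing F)
    (h : F.flatten = X ++ d :: S ++ [c]) (hd : d ∉ X) (hc : c ∉ X ++ d :: S)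
    (hS : 2 ≤ S.length) (hSX : ¬ S <:+: X ++ [d]) :
    ∃ F₁, IsEndParsing F₁ ∧ F₁.flatten = X ++ [d] ∧ F₁.length + 3 ≤ F.length := by
  obtain ⟨F', rfl, hF', hfl⟩ := hF.exists_eq_concat h hc
  obtain ⟨F₁, F₂, rfl, h1, h2⟩ := hF'.exists_eq_of_not_mem hfl hd
  rw [List.append_cons] at hF'
  refine ⟨F₁ ++ [[d]], hF'.of_prefix (List.prefix_append _ _), by simp [h1], ?_⟩
  -- The phrases of `F₂` spell `S`. A single one would be a copy, as `S` has at least two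
  -- characters, and would give an earlier occurrence of `S`.
  match F₂, h2 with
  | [], h2 =>
    rw [← h2] at hS
    simp at hS
  | [f], h2 =>
    obtain rfl : f = S := by simpa using h2
    rcases (hF' _ f List.prefix_rfl).2 with h3 | ⟨P, hP, hfP⟩
    · omega
    · refine absurd ((hfP.isInfix).trans (prefix_of_mem_boundaryPrefixes hP).isInfix) ?_
      simpa [h1] using hSX
  | f :: g :: F₂, _ =>
    simp only [List.length_append, List.length_cons, List.length_nil]
    omega

/-! ### Blocks separated by new characters -/

/-- The string `W · c 0 · S 0 · c 1 · S 1 ⋯ c (k - 1) · S (k - 1)`. -/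
def separatedBlocks (W : List α) (S : ℕ → List α) (c : ℕ → α) : ℕ → List α
  | 0 => W
  | k + 1 => separatedBlocks W S c k ++ c k :: S k

section Blocks

variable {S : ℕ → List α} {c : ℕ → α}

theorem separatedBlocks_eq_append (W : List α) (S : ℕ → List α) (c : ℕ → α) (k : ℕ) :
    separatedBlocks W S c k = W ++ separatedBlocks [] S c k := by
  induction k with
  | zero => simp [separatedBlocks]
  | succ k ih => rw [separatedBlocks, ih, separatedBlocks, List.append_assoc]

theorem length_separatedBlocks_le {l : ℕ} (k : ℕ)
    (hk : ∀ j < k, (S j).length ≤ l) :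
    (separatedBlocks W S c k).length ≤ W.length + k * (l + 1) := by
  induction k with
  | zero => simp [separatedBlocks]
  | succ k ih =>
    rw [separatedBlocks, List.length_append, List.length_cons, Nat.succ_mul]
    have := hk k (by omega)
    have := ih fun j hj => hk j (by omega)
    omega

theorem not_mem_separatedBlocks (hc : Function.Injective c) (hcW : ∀ k, c k ∉ W)
    (hcS : ∀ k j, c k ∉ S j) {j k : ℕ} (hjk : j ≤ k) : c k ∉ separatedBlocks W S c j := by
  induction j with
  | zero => exact hcW k
  | succ j ih =>
    simp only [separatedBlocks, List.mem_append, List.mem_cons, not_or]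
    refine ⟨ih (by omega), fun h => ?_, hcS k j⟩
    have := hc h
    omega

/-- No separator occurs in `V`, so an occurrence of `V` would lie inside `W` or inside a single
block. -/
theorem not_infix_separatedBlocks {V : List α} (hV : ∀ k, c k ∉ V) (hW : ¬ V <:+: W) {k : ℕ}
    (hS : ∀ j < k, ¬ V <:+: S j) : ¬ V <:+: separatedBlocks W S c k := by
  induction k with
  | zero => exact hW
  | succ k ih =>
    intro h
    rcases infix_left_or_right_of_not_mem h (hV k) with h | h
    · exact ih (fun j hj => hS j (by omega)) h
    · exact hS k (by omega) h

/-- The distinct characters of `W` and the separators are forced phrases, and every block is new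
when it appears, so it costs two phrases besides its separator. The final `c K` closes the last
block. -/
theorem IsEndParsing.le_length_of_separatedBlocks (hc : Function.Injective c)
    (hcW : ∀ k, c k ∉ W) (hcS : ∀ k j, c k ∉ S j) (hWn : W.Nodup) (hS2 : ∀ k, 2 ≤ (S k).length)
    {K : ℕ} (hSW : ∀ k < K, ¬ S k <:+: W) (hSS : ∀ j k, j < k → ¬ S k <:+: S j) :
    ∀ {F : List (List α)}, IsEndParsing F → F.flatten = separatedBlocks W S c K ++ [c K] →
      W.length + 1 + 3 * K ≤ F.length := by
  induction K with
  | zero =>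
    intro F hF h
    obtain ⟨F', rfl, hF', hfl⟩ := hF.exists_eq_concat h (hcW 0)
    obtain ⟨F₁, -, -, h3⟩ := IsEndParsing.exists_length_add_le (X := []) hWn (by simp) hF'
      (by simpa [separatedBlocks] using hfl)
    simp only [List.length_append, List.length_singleton]
    omega
  | succ k ih =>
    intro F hF h
    have hinf : ¬ S k <:+: separatedBlocks W S c k ++ [c k] := by
      intro hi
      rcases infix_left_or_right_of_not_mem hi (hcS k k) with hi | hi
      · exact not_infix_separatedBlocks (fun i => hcS i k) (hSW k (by omega))
          (fun j hj => hSS j k hj) hi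
      · have := hi.length_le
        have := hS2 k
        simp only [List.length_nil] at *
        omega
    obtain ⟨F₁, h1, h2, h3⟩ := hF.exists_length_add_three_le h
      (not_mem_separatedBlocks hc hcW hcS le_rfl)
      (not_mem_separatedBlocks (j := k + 1) hc hcW hcS le_rfl) (hS2 k) hinf
    have := ih (fun j hj => hSW j (by omega)) h1 h2
    omega

/-- Parsing `W` into single characters makes each of its prefixes end at a boundary, so every
substring of `W` can be copied as one phrase. The last conjunct carries this through the induction.
-/
theorem exists_isEndParsing_separatedBlocks (hS0 : ∀ k, S k ≠ []) {K : ℕ}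
    (hSW : ∀ k < K, ∃ P, P <+: W ∧ S k <:+ P) :
    ∃ F, IsEndParsing F ∧ F.flatten = separatedBlocks W S c K ++ [c K] ∧
      F.length = W.length + 1 + 2 * K ∧ (W.map fun a => [a]) <+: F := by
  induction K with
  | zero =>
    refine ⟨(W.map fun a => [a]) ++ [[c 0]], ?_, ?_, by simp, List.prefix_append _ _⟩
    · rw [isEndParsing_concat_iff]
      refine ⟨?_, by simp, Or.inl rfl⟩
      simpa using IsEndParsing.nil.append_singletons W
    · rw [List.flatten_concat, flatten_map_singleton, separatedBlocks]
  | succ k ih =>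
    obtain ⟨F, hF, hfl, hlen, hW⟩ := ih fun j hj => hSW j (by omega)
    refine ⟨F ++ [S k] ++ [[c (k + 1)]], ?_, ?_, ?_, ?_⟩
    · rw [isEndParsing_concat_iff, isEndParsing_concat_iff]
      refine ⟨⟨hF, hS0 k, Or.inr ?_⟩, by simp, Or.inl rfl⟩
      obtain ⟨P, hP, hSP⟩ := hSW k (by omega)
      refine ⟨P, ⟨P.map fun a => [a], ?_, flatten_map_singleton P⟩, hSP⟩
      exact (hP.map _).trans hW
    · simp [hfl, separatedBlocks]
    · simp only [List.length_append, List.length_singleton, hlen]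
      omega
    · exact hW.trans (by rw [List.append_assoc]; exact List.prefix_append _ _)

end Blocks

/-! ### The hard strings -/

section Words

variable {e : ℕ × ℕ → α}

/-- The string `e (0, i - 1) ⋯ e (0, 0)`. -/
def leftWord (e : ℕ × ℕ → α) (i : ℕ) : List α := ((List.range i).map fun t => e (0, t)).reverse

/-- The string `e (1, 0) ⋯ e (1, j - 1)`. -/
def rightWord (e : ℕ × ℕ → α) (j : ℕ) : List α := (List.range j).map fun t => e (1, t)

/-- The substring of `leftWord e m ++ x ++ rightWord e m` around `x` with the number `k` in the
lexicographic order of the lengths of its two parts. -/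
def midWord (e : ℕ × ℕ → α) (x : List α) (m k : ℕ) : List α :=
  leftWord e (k / m + 1) ++ x ++ rightWord e (k % m + 1)

theorem leftWord_suffix {i m : ℕ} (h : i ≤ m) : leftWord e i <:+ leftWord e m := by
  obtain ⟨k, rfl⟩ := Nat.exists_eq_add_of_le h
  rw [leftWord, leftWord, List.range_add, List.map_append, List.reverse_append]
  exact List.suffix_append _ _

theorem rightWord_prefix {j m : ℕ} (h : j ≤ m) : rightWord e j <+: rightWord e m := by
  obtain ⟨k, rfl⟩ := Nat.exists_eq_add_of_le h
  rw [rightWord, rightWord, List.range_add, List.map_append]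
  exact List.prefix_append _ _

theorem mem_leftWord (he : Function.Injective e) {p : ℕ × ℕ} {i : ℕ} :
    e p ∈ leftWord e i ↔ p.1 = 0 ∧ p.2 < i := by
  simp only [leftWord, List.mem_reverse, List.mem_map, List.mem_range, he.eq_iff, Prod.ext_iff]
  constructor
  · rintro ⟨a, h, h1, rfl⟩
    exact ⟨h1.symm, h⟩
  · rintro ⟨h1, h⟩
    exact ⟨_, h, h1.symm, rfl⟩

theorem mem_rightWord (he : Function.Injective e) {p : ℕ × ℕ} {i : ℕ} :
    e p ∈ rightWord e i ↔ p.1 = 1 ∧ p.2 < i := by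
  simp only [rightWord, List.mem_map, List.mem_range, he.eq_iff, Prod.ext_iff]
  constructor
  · rintro ⟨a, h, h1, rfl⟩
    exact ⟨h1.symm, h⟩
  · rintro ⟨h1, h⟩
    exact ⟨_, h, h1.symm, rfl⟩

theorem mem_midWord (he : Function.Injective e) {p : ℕ × ℕ} {x : List α} {m k : ℕ} :
    e p ∈ midWord e x m k ↔
      p.1 = 0 ∧ p.2 < k / m + 1 ∨ e p ∈ x ∨ p.1 = 1 ∧ p.2 < k % m + 1 := by
  simp only [midWord, List.mem_append, mem_leftWord he, mem_rightWord he, or_assoc]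

/-- The outermost characters of a word record `k / m` and `k % m`. Containment would force both to
be at most those of `j`, hence `k ≤ j`. -/
theorem not_midWord_infix_midWord (he : Function.Injective e) {x : List α}
    (hx : ∀ p : ℕ × ℕ, p.1 < 3 → e p ∉ x) {m j k : ℕ} (hjk : j < k) :
    ¬ midWord e x m k <:+: midWord e x m j := by
  intro h
  have h0 : e (0, k / m) ∈ midWord e x m j := h.subset ((mem_midWord he).2 (by simp))
  have h1 : e (1, k % m) ∈ midWord e x m j := h.subset ((mem_midWord he).2 (by simp))
  have hx0 := hx (0, k / m) (by simp)
  have hx1 := hx (1, k % m) (by simp)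
  have hkj : k / m ≤ j / m := by simpa [mem_midWord he, hx0] using h0
  have hkj' : k % m ≤ j % m := by simpa [mem_midWord he, hx1] using h1
  have h2 := Nat.div_add_mod k m
  have h3 := Nat.div_add_mod j m
  have := Nat.mul_le_mul_left m hkj
  omega

theorem length_leftWord (m : ℕ) : (leftWord e m).length = m := by simp [leftWord]

theorem length_rightWord (m : ℕ) : (rightWord e m).length = m := by simp [rightWord]

theorem nodup_leftWord (he : Function.Injective e) (m : ℕ) : (leftWord e m).Nodup := by
  rw [leftWord, List.nodup_reverse]
  exact List.nodup_range.map fun a b h => by simpa using he h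

theorem nodup_rightWord (he : Function.Injective e) (m : ℕ) : (rightWord e m).Nodup :=
  List.nodup_range.map fun a b h => by simpa using he h

/-- If an edit of the middle `x` of a string of distinct characters destroys all substrings around
`x`, the number of phrases of some string of length `n` increases by about `m ^ 2`. -/
theorem exists_lzEndOpt_add_le (he : Function.Injective e) {x y : List α} {m n : ℕ} (hm : 0 < m)
    (hn : 8 * m ^ 3 ≤ n) (hxl : x.length ≤ 1) (hx : ∀ p : ℕ × ℕ, p.1 < 3 → e p ∉ x)
    (hy : ∀ p : ℕ × ℕ, p.1 < 3 → e p ∉ y)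
    (hW : (leftWord e m ++ y ++ rightWord e m).Nodup)
    (hxy : ∀ k < m ^ 2, ¬ midWord e x m k <:+: leftWord e m ++ y ++ rightWord e m) :
    ∃ A B : List α, (A ++ x ++ B).length = n ∧
      lzEndOpt (A ++ x ++ B) + y.length + m ^ 2 ≤ lzEndOpt (A ++ y ++ B) + x.length := by
  -- The first coordinate of `e` separates the roles: 0 and 1 for the two sides, 2 for separators
  -- and padding, leaving 3 for the edited characters.
  set c : ℕ → α := fun k => e (2, k) with hc_def
  set S := midWord e x m with hS_def
  have hc : Function.Injective c := fun a b h => by simpa using he h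
  have hcW : ∀ z : List α, (∀ p : ℕ × ℕ, p.1 < 3 → e p ∉ z) →
      ∀ k, c k ∉ leftWord e m ++ z ++ rightWord e m := by
    intro z hz k
    have := hz (2, k) (by simp)
    simp [hc_def, mem_leftWord he, mem_rightWord he, this]
  have hcS : ∀ k j, c k ∉ S j := by
    intro k j
    have := hx (2, k) (by simp)
    simp [hS_def, hc_def, mem_midWord he, this]
  have hSl : ∀ k, (S k).length = k / m + k % m + 2 + x.length := by
    intro k
    simp only [hS_def, midWord, List.length_append, length_leftWord, length_rightWord]
    omega
  have hS2 : ∀ k, 2 ≤ (S k).length := by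
    intro k
    have := Nat.zero_le (k / m)
    have := Nat.zero_le (k % m)
    rw [hSl]
    omega
  have hdiv : ∀ k < m ^ 2, k / m < m := fun k hk =>
    Nat.div_lt_of_lt_mul (by rwa [sq] at hk)
  have hmod : ∀ k, k % m < m := fun k => Nat.mod_lt k hm
  set K := m ^ 2 with hK
  set T := fun z : List α => separatedBlocks (leftWord e m ++ z ++ rightWord e m) S c K ++ [c K]
    with hT
  have hTl : (T x).length ≤ n := by
    have h1 : (separatedBlocks (leftWord e m ++ x ++ rightWord e m) S c K).length ≤ _ :=
      length_separatedBlocks_le (l := 2 * m + 1) K (by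
        intro j hj
        have := hdiv j hj
        have := hmod j
        rw [hSl]
        omega)
    simp only [hT, List.length_append, List.length_singleton, length_leftWord,
      length_rightWord] at h1 ⊢
    have : K * (2 * m + 1 + 1) = 2 * m ^ 3 + 2 * m ^ 2 := by rw [hK]; ring
    have : m ^ 2 ≤ m ^ 3 := Nat.pow_le_pow_right hm (by norm_num)
    have : m ^ 1 ≤ m ^ 3 := Nat.pow_le_pow_right hm (by norm_num)
    rw [pow_one] at this
    omega
  -- Padding by unused separators reaches the exact length `n` and adds the same number of phrases
  -- before and after the edit.
  set Z : List α := (List.range (n - (T x).length)).map fun t => c (K + 1 + t) with hZ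
  have hTZ : ∀ z, T z ++ Z = leftWord e m ++ z ++
      (rightWord e m ++ separatedBlocks [] S c K ++ [c K] ++ Z) := by
    intro z
    simp only [hT]
    rw [separatedBlocks_eq_append]
    simp only [List.append_assoc]
  have hZl : Z.length = n - (T x).length := by simp [hZ]
  refine ⟨leftWord e m, rightWord e m ++ separatedBlocks [] S c K ++ [c K] ++ Z, ?_, ?_⟩
  · rw [← hTZ, List.length_append, hZl]
    omega
  rw [← hTZ, ← hTZ]
  have hupper : lzEndOpt (T x ++ Z) ≤ 2 * m + x.length + 1 + 2 * K + Z.length := by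
    obtain ⟨F, hF, hfl, hlen, -⟩ := exists_isEndParsing_separatedBlocks (S := S) (c := c) (K := K)
      (W := leftWord e m ++ x ++ rightWord e m)
      (fun k h => by have := hS2 k; rw [h] at this; simp at this) (by
        intro k hk
        refine ⟨leftWord e m ++ x ++ rightWord e (k % m + 1), ?_, ?_⟩
        · exact (List.prefix_append_right_inj _).2 (rightWord_prefix (hmod k))
        · obtain ⟨t, ht⟩ := leftWord_suffix (e := e) (hdiv k hk)
          exact ⟨t, by simp [hS_def, midWord, ← ht]⟩)
    have := (hF.append_singletons Z).lzEndOpt_le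
    rw [List.flatten_append, flatten_map_singleton, hfl] at this
    change lzEndOpt (T x ++ Z) ≤ _ at this
    simp only [List.length_append, List.length_map, length_leftWord, length_rightWord] at this hlen
    omega
  have hlower : 2 * m + y.length + 1 + 3 * K + Z.length ≤ lzEndOpt (T y ++ Z) := by
    obtain ⟨F, hF, hfl, hlen⟩ := exists_isEndParsing_length_eq (T y ++ Z)
    obtain ⟨F₁, h1, h2, h3⟩ := IsEndParsing.exists_length_add_le (X := T y) (Z := Z)
      (List.nodup_range.map fun a b h => by have := hc h; omega) (by
        intro a ha
        obtain ⟨t, -, rfl⟩ := List.mem_map.1 ha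
        simp only [hT, List.mem_append, List.mem_singleton, not_or]
        refine ⟨not_mem_separatedBlocks hc (hcW y hy) hcS (by omega), fun h => ?_⟩
        have := hc h
        omega) hF hfl
    have := IsEndParsing.le_length_of_separatedBlocks hc (hcW y hy) hcS hW
      hS2 hxy
      (fun j k hjk => not_midWord_infix_midWord he hx hjk) h1 h2
    simp only [List.length_append, length_leftWord, length_rightWord] at this
    omega
  omega

theorem nodup_left_append_right (he : Function.Injective e) {y : List α} (m : ℕ) (hyn : y.Nodup)
    (hy : ∀ p : ℕ × ℕ, p.1 < 3 → e p ∉ y) : (leftWord e m ++ y ++ rightWord e m).Nodup := by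
  have hl : ∀ a ∈ leftWord e m, ∃ t, a = e (0, t) := by
    intro a ha
    simp only [leftWord, List.mem_reverse, List.mem_map] at ha
    obtain ⟨t, -, rfl⟩ := ha
    exact ⟨t, rfl⟩
  have hr : ∀ a ∈ rightWord e m, ∃ t, a = e (1, t) := by
    intro a ha
    simp only [rightWord, List.mem_map] at ha
    obtain ⟨t, -, rfl⟩ := ha
    exact ⟨t, rfl⟩
  refine List.Nodup.append (List.Nodup.append (nodup_leftWord he m) hyn ?_)
    (nodup_rightWord he m) ?_
  · intro a ha hay
    obtain ⟨t, rfl⟩ := hl a ha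
    exact hy _ (by simp) hay
  · intro a ha har
    obtain ⟨t, rfl⟩ := hr a har
    rcases List.mem_append.1 ha with h | h
    · simpa using (mem_leftWord he).1 h
    · exact hy _ (by simp) h

theorem exists_singleEdit_lzEndOpt_add_le (he : Function.Injective e) (t : EditType) {m n : ℕ}
    (hm : 0 < m) (hn : 8 * m ^ 3 ≤ n) :
    ∃ T T' : List α, T.length = n ∧ SingleEdit t T T' ∧
      lzEndOpt T + m ^ 2 ≤ lzEndOpt T' + 1 := by
  have hmem : ∀ i (p : ℕ × ℕ), p.1 < 3 → e p ∉ [e (3, i)] := by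
    intro i p hp h
    have := he (List.mem_singleton.1 h)
    simp [this] at hp
  have hne : e (3, 0) ≠ e (3, 1) := fun h => by simpa using he h
  have hmid : ∀ {i : ℕ} {z : List α}, e (3, i) ∉ z → ∀ k,
      ¬ midWord e [e (3, i)] m k <:+: leftWord e m ++ z ++ rightWord e m := by
    intro i z hz k h
    have := h.subset ((mem_midWord he (p := (3, i))).2 (by simp))
    simp [mem_leftWord he, mem_rightWord he, hz] at this
  cases t with
  | sub =>
    obtain ⟨A, B, hl, h⟩ := exists_lzEndOpt_add_le he (x := [e (3, 0)]) (y := [e (3, 1)]) hm hn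
      (by simp) (hmem 0) (hmem 1) (nodup_left_append_right he m (by simp) (hmem 1))
      (fun k _ => hmid (by simpa using hne) k)
    simp only [List.append_assoc, List.singleton_append, List.length_singleton] at hl h
    exact ⟨_, _, hl, .sub A B _ _ hne, by omega⟩
  | ins =>
    obtain ⟨A, B, hl, h⟩ := exists_lzEndOpt_add_le he (x := []) (y := [e (3, 1)]) hm hn
      -- Every word has at least one character on either side of the insertion point, and the
      -- inserted character separates these two neighbours.
      (by simp) (by simp) (hmem 1) (nodup_left_append_right he m (by simp) (hmem 1)) (by
        intro k _ hi
        have h0 : e (0, 0) ∈ midWord e [] m k := (mem_midWord he).2 (by simp)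
        have h1 : e (1, 0) ∈ midWord e [] m k := (mem_midWord he).2 (by simp)
        rw [List.append_assoc, List.singleton_append] at hi
        rcases infix_left_or_right_of_not_mem hi (by simp [mem_midWord he]) with hi | hi
        · simpa using (mem_leftWord he).1 (hi.subset h1)
        · simpa using (mem_rightWord he).1 (hi.subset h0))
    simp only [List.append_assoc, List.singleton_append, List.length_singleton, List.nil_append,
      List.length_nil] at hl h
    exact ⟨_, _, hl, .ins A B (e (3, 1)), by omega⟩
  | del =>
    obtain ⟨A, B, hl, h⟩ := exists_lzEndOpt_add_le he (x := [e (3, 0)]) (y := []) hm hn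
      (by simp) (hmem 0) (by simp) (nodup_left_append_right he m (by simp) (by simp))
      (fun k _ => hmid (by simp) k)
    simp only [List.append_assoc, List.singleton_append, List.length_singleton, List.nil_append,
      List.length_nil] at hl h
    exact ⟨_, _, hl, .del A B _, by omega⟩

end Words

theorem le_additiveSensitivity_lzEndOpt (α : Type*) [Infinite α] (t : EditType) {n : ℕ}
    (hn : 64 ≤ n) :
    (1 / 32 : ℝ) * (n : ℝ) ^ (2 / 3 : ℝ) ≤ (additiveSensitivity t (lzEndOpt (α := α)) n : ℝ) := by
  have hn1 : (64 : ℝ) ≤ n := by exact_mod_cast hn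
  have hn0 : (0 : ℝ) ≤ n := by linarith
  set s : ℝ := (n : ℝ) ^ (1 / 3 : ℝ) with hs
  have hs0 : 0 ≤ s := by positivity
  have hs3 : s ^ 3 = n := by
    rw [hs, ← Real.rpow_natCast, ← Real.rpow_mul hn0]
    norm_num
  have hs2 : (n : ℝ) ^ (2 / 3 : ℝ) = s ^ 2 := by
    rw [hs, ← Real.rpow_natCast, ← Real.rpow_mul hn0]
    norm_num
  have hs4 : 4 ≤ s := by
    by_contra! h
    have := pow_lt_pow_left₀ h hs0 (n := 3) (by norm_num)
    linarith
  -- Half the cube root gives `8 * m ^ 3 ≤ n`; the assumption `64 ≤ n` gives `2 ≤ m`, so the loss of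
  -- 1 in `m ^ 2 - 1` is harmless.
  set m := ⌊s / 2⌋₊ with hm
  have hm2 : 2 ≤ m := Nat.le_floor (by push_cast; linarith)
  have hm2' : (2 : ℝ) ≤ m := by exact_mod_cast hm2
  have hms : (m : ℝ) ≤ s / 2 := Nat.floor_le (by linarith)
  have hsm : s / 2 < m + 1 := Nat.lt_floor_add_one _
  have hmn : 8 * m ^ 3 ≤ n := by
    have h1 : (m : ℝ) ^ 3 ≤ (s / 2) ^ 3 := pow_le_pow_left₀ (by linarith) hms 3
    have h2 : (8 : ℝ) * (m : ℝ) ^ 3 ≤ n := by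
      rw [← hs3]
      nlinarith
    exact_mod_cast h2
  have he : Function.Injective fun p : ℕ × ℕ => Infinite.natEmbedding α (Nat.pairEquiv p) :=
    (Infinite.natEmbedding α).injective.comp Nat.pairEquiv.injective
  obtain ⟨T, T', hT, hed, h⟩ := exists_singleEdit_lzEndOpt_add_le he t (by omega) hmn
  have hmem : (lzEndOpt T' : ℤ) - lzEndOpt T ∈ sensitivitySet t (lzEndOpt (α := α)) n := by
    obtain ⟨h1, h2⟩ := (editDist_eq_one_iff t T T').2 hed
    exact ⟨T, T', hT, hT ▸ h1, h2, rfl⟩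
  have h1 := (isGreatest_additiveSensitivity t n ⟨_, hmem⟩).2 hmem
  have h2 : (m : ℤ) ^ 2 - 1 ≤ additiveSensitivity t (lzEndOpt (α := α)) n := by
    have : (lzEndOpt T : ℤ) + (m : ℤ) ^ 2 ≤ lzEndOpt T' + 1 := by exact_mod_cast h
    linarith
  have h3 : (m : ℝ) ^ 2 - 1 ≤ (additiveSensitivity t (lzEndOpt (α := α)) n : ℝ) := by
    exact_mod_cast h2
  rw [hs2]
  nlinarith

end Lower

theorem mainTheorem5 :
    (∃ C : ℝ, ∀ (α : Type u) (e : EditType) (n : ℕ), 1 ≤ n →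
      (additiveSensitivity e (lzEndOpt (α := α)) n : ℝ) ≤ C * (n : ℝ) ^ (2 / 3 : ℝ)) ∧
    (∃ c : ℝ, 0 < c ∧ ∃ N : ℕ, ∀ (α : Type u) [Infinite α] (e : EditType) (n : ℕ), N ≤ n →
      c * (n : ℝ) ^ (2 / 3 : ℝ) ≤ (additiveSensitivity e (lzEndOpt (α := α)) n : ℝ)) :=
  ⟨⟨36, fun α e _ hn => additiveSensitivity_lzEndOpt_le α e hn⟩,
    1 / 32, by norm_num, 64, fun α _ e _ hn => le_additiveSensitivity_lzEndOpt α e hn⟩
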